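/- **Setting.** A stochastic block model $\mathcal G(\boldsymbol n,P)$ is given by a positive integer $k$, a vector $\boldsymbol n=(n_1,\dots,n_k)$ of non-negative integers and a symmetric $k\times k$ matrix $P=(p_{ij})$ with $0\le p_{ij}<1$. Its random graph $\mathbf G$ has a vertex set that is the disjoint union of blocks $B_1,\dots,B_k$ with $|B_i|=n_i$, and each pair $\{u,v\}$ of distinct vertices, $u\in B_i$, $v\in B_j$, is an edge with probability $p_{ij}$, independently of all other pairs. Write $\|\boldsymbol n\|=n_1+\dots+n_k$, $n_*=\min_i n_i$, $q_{ij}=\log\frac1{1-p_{ij}}$, $Q=(q_{ij})$, $q^*=\max_i q_{ii}$, $\hat q(\boldsymbol n)=\frac1{\|\boldsymbol n\|}\sum_i n_iq_{ii}$, and $$w(\boldsymbol n)=\max_{\boldsymbol 0\preceq \boldsymbol y\preceq \boldsymbol n}\frac{\boldsymbol y^TQ\boldsymbol y}{\|\boldsymbol y\|},$$ where $\boldsymbol y$ ranges over real vectors with $0\le y_i\le n_i$ for all $i$, $\|\boldsymbol y\|=\sum_i|y_i|$, and the quotient is $0$ at $\boldsymbol y=\boldsymbol 0$. For a nonempty set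 $U$ of vertices let $h(U)=-\frac{1}{|U|}\log\Pr(U\text{ is independent in }\mathbf G)$. The weighted independence number $\alpha_h(G)$ of a graph $G$ on this vertex set is the maximum of $h(U)$ over all nonempty independent sets $U$ of $G$. **Theorem 4.4.** Let $0<\sigma_0<\frac12$ be fixed and let $T$ be a set. For every $m\in\mathbb N$ and $t\in T$ let a stochastic block model with parameters $k$, $\boldsymbol n$, $P$ and a number $\sigma\in[0,\sigma_0]$ be given, all depending on $(m,t)$. All asymptotic statements below are for $m\to\infty$, uniformly in $t\in T$ (if $T$ has one point, this is the case of a single sequence of models); $X=Y^{a+o(1)}$ means that $X=Y^{a+e}$ for all sufficiently large $m$ with some $e=e(m,t)\to0$, and $X\ll Y$ (equivalently, $Y\gg X$) means $X=o(Y)$. Suppose that $$\|\boldsymbol n\|\to\infty,\qquad k=\|\boldsymbol n\|^{o(1)},\qquad q^*=\|\boldsymbol n\|^{-\sigma+o(1)},\qquad \hat q(\boldsymbol n)=\|\boldsymbol n\|^{-\sigma+o(1)},$$ $$\Bigl(1+\frac1{q^*}\Bigr)\max_{i,j}q_{ij}\ll\log\|\boldsymbol n\|,\qquad n_*=\|\boldsymbol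 n\|^{1+o(1)},\qquad n_*\gg\frac{w(\boldsymbol n)}{\log\|\boldsymbol n\|}.$$ Then $\alpha_h(\mathbf G)=(1-\sigma+o(1))\log\|\boldsymbol n\|$ with high probability, that is, for every fixed $\varepsilon>0$, $$\Pr\Bigl((1-\sigma-\varepsilon)\log\|\boldsymbol n\|\le\alpha_h(\mathbf G)\le(1-\sigma+\varepsilon)\log\|\boldsymbol n\|\Bigr)\to1 .$$ -/

import Mathlib

open Filter Topology MeasureTheory ProbabilityTheory Asymptotics

/-- `X = Y ^ (a + o(1))` along the filter `l`. -/
def EqPowLittleO {ι : Type*} (l : Filter ι) (X Y a : ι → ℝ) : Prop :=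
  ∃ e : ι → ℝ, Tendsto e l (𝓝 0) ∧ ∀ᶠ i in l, X i = Y i ^ (a i + e i)

/-- The parameters of a stochastic block model: a positive number `k` of blocks, the vector `n` of
block sizes, and the symmetric matrix `P` of edge probabilities, with entries in `[0, 1)`. -/
structure StochasticBlockModel where
  k : ℕ
  k_pos : 0 < k
  n : Fin k → ℕ
  P : Matrix (Fin k) (Fin k) ℝ
  P_symm : ∀ i j, P i j = P j i
  P_nonneg : ∀ i j, 0 ≤ P i j
  P_lt_one : ∀ i j, P i j < 1

namespace StochasticBlockModel

/-- The vertices: the `i`-th block is `{⟨i, a⟩ | a : Fin (n i)}`, a set of size `n i`. -/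
abbrev Vertex (M : StochasticBlockModel) : Type := Σ i : Fin M.k, Fin (M.n i)

/-- The probability `p(u, v)` that the pair `{u, v}` is an edge. -/
def edgeProb (M : StochasticBlockModel) (e : Sym2 M.Vertex) : unitInterval :=
  ⟨Sym2.lift ⟨fun u v => M.P u.1 v.1, fun u v => M.P_symm u.1 v.1⟩ e,
    Sym2.ind (fun u v => ⟨M.P_nonneg u.1 v.1, (M.P_lt_one u.1 v.1).le⟩) e⟩

/-- The law of the random graph: toss independent coins, the coin of the pair `e` being `true` with
probability `p(e)`, and take the graph whose edges are the pairs of *distinct* vertices with value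
`true` (`SimpleGraph.fromEdgeSet` ignores the coins of the diagonal pairs). -/
noncomputable def law (M : StochasticBlockModel) : Measure (SimpleGraph M.Vertex) :=
  (Measure.pi fun e : Sym2 M.Vertex => bernoulliMeasure true false (M.edgeProb e)).map
    fun ω => SimpleGraph.fromEdgeSet {e | ω e = true}

instance (M : StochasticBlockModel) : IsProbabilityMeasure M.law :=
  Measure.isProbabilityMeasure_map Measurable.of_discrete.aemeasurable

/-- Every event about the graph is measurable. -/
instance (M : StochasticBlockModel) : DiscreteMeasurableSpace (SimpleGraph M.Vertex) where
  forall_measurableSet s :=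
    (SimpleGraph.measurableEmbedding_edgeSet (V := M.Vertex)).measurableSet_image.1
      (Set.toFinite (SimpleGraph.edgeSet '' s)).measurableSet

/-- `‖n‖`, the number of vertices. -/
def size (M : StochasticBlockModel) : ℝ := ∑ i, (M.n i : ℝ)

/-- `n_*`, the size of the smallest block. -/
noncomputable def minBlock (M : StochasticBlockModel) : ℝ := ⨅ i, (M.n i : ℝ)

/-- The matrix `Q` with entries `q i j = log (1 / (1 - p i j))`. -/
noncomputable def Q (M : StochasticBlockModel) : Matrix (Fin M.k) (Fin M.k) ℝ :=
  fun i j => Real.log (1 / (1 - M.P i j))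

/-- The largest entry of `Q`. -/
noncomputable def maxQ (M : StochasticBlockModel) : ℝ := ⨆ i, ⨆ j, M.Q i j

/-- `q^*`, the largest diagonal entry of `Q`. -/
noncomputable def qStar (M : StochasticBlockModel) : ℝ := ⨆ i, M.Q i i

/-- `q̂(n)`, the average of the diagonal entries of `Q` weighted by the block sizes. -/
noncomputable def qHat (M : StochasticBlockModel) : ℝ :=
  (∑ i, (M.n i : ℝ) * M.Q i i) / M.size

end StochasticBlockModel

/-- `w(x, Q)`, the maximum of `yᵀ Q y / ‖y‖₁` over `0 ≤ y ≤ x` coordinatewise; the quotient is `0`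
at `y = 0`. -/
noncomputable def wFun {k : ℕ} (Q : Matrix (Fin k) (Fin k) ℝ) (x : Fin k → ℝ) : ℝ :=
  sSup ((fun y : Fin k → ℝ => (y ⬝ᵥ Q.mulVec y) / ∑ i, |y i|) '' Set.Icc 0 x)

namespace StochasticBlockModel

/-- `w(n) = w(n, Q)` at the vector `n` of block sizes. -/
noncomputable def w (M : StochasticBlockModel) : ℝ := wFun M.Q fun i => (M.n i : ℝ)

/-- The weight `h(U) = - log (Pr(U is independent)) / |U|` of a set of vertices. -/
noncomputable def weight (M : StochasticBlockModel) (U : Finset M.Vertex) : ℝ :=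
  -Real.log (M.law.real {G | G.IsIndepSet (U : Set M.Vertex)}) / U.card

/-- The weighted independence number `α_h(G)`, the maximum of `h(U)` over the nonempty independent
sets `U` of `G`. -/
noncomputable def weightedIndepNum (M : StochasticBlockModel) (G : SimpleGraph M.Vertex) : ℝ :=
  ⨆ U : {U : Finset M.Vertex // U.Nonempty ∧ G.IsIndepSet (U : Set M.Vertex)}, M.weight U.1

end StochasticBlockModel

/-! Both bounds are moment arguments. By independence of the pairs, a set `U` is independent with
probability `exp (-|U| h(U))`. Write `L = log ‖n‖`.

Upper bound, by the first moment: `h(U)` is at most `|U| * maxQ / 2`, and `maxQ` is small compared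
with `L * qStar`, so a set of weight above `(1 - σ + ε) L` has at least about `‖n‖ ^ σ` vertices.
For such sizes `u`, the number `(e ‖n‖ / u) ^ u` of candidates loses to the probability `exp (-u (1
- σ + ε) L)`; this is `law_real_lt_weightedIndepNum_le`.

Lower bound, by the second moment inside one block: some block has diagonal entry `q ≥ qHat`, and
all blocks have size `‖n‖ ^ (1 + o(1))`. Independent sets of size about `2 (1 - σ - ε) L / q` in
that block have the required weight. In the variance (`law_real_forall_not_isIndepSet_le`), an
overlap of size `l` contributes at most the `l`-th power of a base whose logarithm is convex in `l`,
so only `l = 1` and full overlap matter. The former is harmless because `σ < 1/2`, the latter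
because the weight stays below `(1 - σ) L`. -/

/-! ### Pairs inside a vertex set -/

open scoped Classical in
/-- The pairs of distinct elements of a finite set. -/
noncomputable def Finset.offDiagPairs {V : Type*} (U : Finset V) : Finset (Sym2 V) :=
  U.offDiag.image Sym2.mk.uncurry

namespace Finset

variable {V : Type*}

theorem mk_mem_offDiagPairs {U : Finset V} {a b : V} :
    s(a, b) ∈ U.offDiagPairs ↔ a ∈ U ∧ b ∈ U ∧ a ≠ b := by
  classical
  simp only [offDiagPairs, mem_image, mem_offDiag, Prod.exists, Function.uncurry_apply_pair,
    Sym2.eq_iff]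
  constructor
  · rintro ⟨x, y, ⟨hx, hy, hxy⟩, ⟨rfl, rfl⟩ | ⟨rfl, rfl⟩⟩
    · exact ⟨hx, hy, hxy⟩
    · exact ⟨hy, hx, hxy.symm⟩
  · rintro ⟨ha, hb, hab⟩
    exact ⟨a, b, ⟨ha, hb, hab⟩, Or.inl ⟨rfl, rfl⟩⟩

theorem card_offDiagPairs (U : Finset V) : U.offDiagPairs.card = U.card.choose 2 := by
  classical
  rw [← Sym2.card_image_offDiag, offDiagPairs]

theorem offDiagPairs_inter [DecidableEq V] [DecidableEq (Sym2 V)] (U W : Finset V) :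
    U.offDiagPairs ∩ W.offDiagPairs = (U ∩ W).offDiagPairs := by
  ext e
  induction e using Sym2.ind with
  | _ a b => simp only [mem_inter, mk_mem_offDiagPairs]; tauto

theorem not_isDiag_of_mem_offDiagPairs {U : Finset V} {e : Sym2 V} (he : e ∈ U.offDiagPairs) :
    ¬ e.IsDiag := by
  induction e using Sym2.ind with
  | _ a b => simpa using (mk_mem_offDiagPairs.1 he).2.2

theorem isIndepSet_iff_offDiagPairs (G : SimpleGraph V) (U : Finset V) :
    G.IsIndepSet (U : Set V) ↔ ∀ e ∈ U.offDiagPairs, e ∉ G.edgeSet := by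
  constructor
  · intro h e he
    induction e using Sym2.ind with
    | _ a b =>
      obtain ⟨ha, hb, hab⟩ := mk_mem_offDiagPairs.1 he
      exact h ha hb hab
  · intro h a ha b hb hab
    exact h s(a, b) (mk_mem_offDiagPairs.2 ⟨ha, hb, hab⟩)

end Finset

/-- The second moment method for a finite family of events. -/
theorem MeasureTheory.measureReal_forall_notMem_le {Ω ι : Type*} [MeasurableSpace Ω] [Finite Ω]
    [DiscreteMeasurableSpace Ω] (μ : Measure Ω) [IsProbabilityMeasure μ] (F : Finset ι)
    (A : ι → Set Ω) :
    (∑ i ∈ F, μ.real (A i)) ^ 2 * μ.real {x | ∀ i ∈ F, x ∉ A i} ≤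
      ∑ i ∈ F, ∑ j ∈ F, (μ.real (A i ∩ A j) - μ.real (A i) * μ.real (A j)) := by
  classical
  have hm : ∀ s : Set Ω, MeasurableSet s := fun s => MeasurableSet.of_discrete
  set a := ∑ i ∈ F, μ.real (A i) with ha
  set X : Ω → ℝ := fun x => ∑ i ∈ F, (A i).indicator (fun _ => (1 : ℝ)) x with hX
  have hint : ∀ f : Ω → ℝ, Integrable f μ := fun f => Integrable.of_finite
  have hEX : ∫ x, X x ∂μ = a := by
    rw [hX, integral_finsetSum _ fun i _ => hint _]
    exact Finset.sum_congr rfl fun i _ => by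
      rw [integral_indicator_const _ (hm _)]; simp
  have hEX2 : ∫ x, X x ^ 2 ∂μ = ∑ i ∈ F, ∑ j ∈ F, μ.real (A i ∩ A j) := by
    have : ∀ x, X x ^ 2 = ∑ i ∈ F, ∑ j ∈ F, (A i ∩ A j).indicator (fun _ => (1 : ℝ)) x := by
      intro x
      rw [hX, sq, Finset.sum_mul_sum]
      refine Finset.sum_congr rfl fun i _ => Finset.sum_congr rfl fun j _ => ?_
      by_cases h1 : x ∈ A i <;> by_cases h2 : x ∈ A j <;> simp [h1, h2]
    simp_rw [this]
    rw [integral_finsetSum _ fun i _ => hint _]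
    refine Finset.sum_congr rfl fun i _ => ?_
    rw [integral_finsetSum _ fun i _ => hint _]
    exact Finset.sum_congr rfl fun j _ => by
      rw [integral_indicator_const _ (hm _)]; simp
  have hvar : ∫ x, (X x - a) ^ 2 ∂μ = (∑ i ∈ F, ∑ j ∈ F, μ.real (A i ∩ A j)) - a ^ 2 := by
    have : ∀ x, (X x - a) ^ 2 = X x ^ 2 - 2 * a * X x + a ^ 2 := fun x => by ring
    simp_rw [this]
    rw [integral_add (hint _) (hint _), integral_sub (hint _) (hint _), integral_const_mul,
      hEX, hEX2]
    simp
    ring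
  have hlow : a ^ 2 * μ.real {x | ∀ i ∈ F, x ∉ A i} ≤ ∫ x, (X x - a) ^ 2 ∂μ := by
    have h1 : ∫ x, {x | ∀ i ∈ F, x ∉ A i}.indicator (fun _ => a ^ 2) x ∂μ ≤
        ∫ x, (X x - a) ^ 2 ∂μ := by
      refine integral_mono (hint _) (hint _) fun x => ?_
      by_cases hx : ∀ i ∈ F, x ∉ A i
      -- Chebyshev's step: where no event occurs the counter vanishes, so its squared deviation from
      -- the mean is exactly `a ^ 2`.
      · have : X x = 0 := Finset.sum_eq_zero fun i hi => by simp [hx i hi]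
        rw [Set.indicator_of_mem (show x ∈ {x | ∀ i ∈ F, x ∉ A i} from hx), this]
        simp
      · have : x ∉ {x | ∀ i ∈ F, x ∉ A i} := hx
        rw [Set.indicator_of_notMem this]
        positivity
    rw [integral_indicator_const _ (hm _)] at h1
    simpa [mul_comm] using h1
  refine hlow.trans (le_of_eq ?_)
  rw [hvar, ha, sq, Finset.sum_mul_sum]
  simp_rw [Finset.sum_sub_distrib]

/-! ### Probabilities of independent sets, and weights -/

namespace StochasticBlockModel

variable (M : StochasticBlockModel)

/-- The entry of `Q` that belongs to a pair of vertices. -/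
noncomputable def pairQ (e : Sym2 M.Vertex) : ℝ :=
  -Real.log (1 - (M.edgeProb e : ℝ))

theorem Q_eq (i j : Fin M.k) : M.Q i j = -Real.log (1 - M.P i j) := by
  simp [Q]

theorem pairQ_mk (u v : M.Vertex) : M.pairQ s(u, v) = M.Q u.1 v.1 := by
  rw [Q_eq]; rfl

theorem Q_nonneg (i j : Fin M.k) : 0 ≤ M.Q i j := by
  rw [Q_eq, neg_nonneg]
  exact Real.log_nonpos (by linarith [M.P_lt_one i j]) (by linarith [M.P_nonneg i j])

theorem edgeProb_lt_one (e : Sym2 M.Vertex) : (M.edgeProb e : ℝ) < 1 := by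
  induction e using Sym2.ind with
  | _ u v => exact M.P_lt_one _ _

theorem exp_neg_pairQ (e : Sym2 M.Vertex) : Real.exp (-M.pairQ e) = 1 - (M.edgeProb e : ℝ) := by
  rw [pairQ, neg_neg, Real.exp_log (by linarith [M.edgeProb_lt_one e])]

/-- The event is a cylinder in the product of coins. Diagonal pairs must be excluded: they are never
edges, whatever their coin shows. -/
theorem law_real_forall_notMem_edgeSet (S : Finset (Sym2 M.Vertex))
    (hS : ∀ e ∈ S, ¬ e.IsDiag) :
    M.law.real {G | ∀ e ∈ S, e ∉ G.edgeSet} = Real.exp (-∑ e ∈ S, M.pairQ e) := by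
  classical
  rw [← Finset.sum_neg_distrib, Real.exp_sum, law,
    map_measureReal_apply Measurable.of_discrete MeasurableSet.of_discrete]
  have hpre : (fun ω : Sym2 M.Vertex → Bool => SimpleGraph.fromEdgeSet {e | ω e = true}) ⁻¹'
      {G | ∀ e ∈ S, e ∉ G.edgeSet} =
      Set.pi Set.univ fun e => if e ∈ S then {false} else Set.univ := by
    ext ω
    simp only [Set.mem_preimage, Set.mem_ofPred_eq, SimpleGraph.edgeSet_fromEdgeSet, Set.mem_sdiff,
      Set.mem_pi, Set.mem_univ, true_imp_iff]
    refine forall_congr' fun e => ?_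
    by_cases he : e ∈ S
    · have := hS e he
      simp [he, this]
    · simp [he]
  rw [hpre, measureReal_def, Measure.pi_pi, ENNReal.toReal_prod, ← Finset.prod_subset S.subset_univ]
  · refine Finset.prod_congr rfl fun e he => ?_
    rw [exp_neg_pairQ, if_pos he, ← measureReal_def,
      bernoulliMeasure_real_apply_of_notMem_of_mem _ (by measurability) (by simp) (by simp)]
  · intro e _ he
    simp [he]

theorem law_real_isIndepSet (U : Finset M.Vertex) :
    M.law.real {G | G.IsIndepSet (U : Set M.Vertex)} =
      Real.exp (-∑ e ∈ U.offDiagPairs, M.pairQ e) := by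
  simp_rw [Finset.isIndepSet_iff_offDiagPairs]
  exact M.law_real_forall_notMem_edgeSet _ fun e he => Finset.not_isDiag_of_mem_offDiagPairs he

theorem weight_eq (U : Finset M.Vertex) :
    M.weight U = (∑ e ∈ U.offDiagPairs, M.pairQ e) / U.card := by
  rw [weight, law_real_isIndepSet, Real.log_exp, neg_neg]

theorem law_real_isIndepSet_eq_exp_weight {U : Finset M.Vertex} (hU : U.Nonempty) :
    M.law.real {G | G.IsIndepSet (U : Set M.Vertex)} = Real.exp (-(U.card * M.weight U)) := by
  have : (U.card : ℝ) ≠ 0 := by exact_mod_cast hU.card_pos.ne'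
  rw [law_real_isIndepSet, weight_eq, mul_div_cancel₀ _ this]

theorem Q_le_maxQ (i j : Fin M.k) : M.Q i j ≤ M.maxQ :=
  (le_ciSup (Set.finite_range fun j => M.Q i j).bddAbove j).trans
    (le_ciSup (Set.finite_range fun i => ⨆ j, M.Q i j).bddAbove i)

theorem maxQ_nonneg : 0 ≤ M.maxQ :=
  (M.Q_nonneg ⟨0, M.k_pos⟩ ⟨0, M.k_pos⟩).trans (M.Q_le_maxQ _ _)

theorem minBlock_le (i : Fin M.k) : M.minBlock ≤ M.n i :=
  ciInf_le (Set.finite_range fun i => (M.n i : ℝ)).bddBelow i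

theorem exists_qHat_le (hM : 0 < M.size) : ∃ i, M.qHat ≤ M.Q i i := by
  by_contra! h
  have hpos : ∃ i, 0 < (M.n i : ℝ) := by
    by_contra! h0
    exact absurd (Finset.sum_nonpos fun i _ => h0 i) (not_le.2 hM)
  obtain ⟨i, hi⟩ := hpos
  have : ∑ i, (M.n i : ℝ) * M.Q i i < ∑ i, (M.n i : ℝ) * M.qHat :=
    Finset.sum_lt_sum (fun j _ => mul_le_mul_of_nonneg_left (h j).le (Nat.cast_nonneg _))
      ⟨i, Finset.mem_univ _, mul_lt_mul_of_pos_left (h i) hi⟩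
  rw [← Finset.sum_mul, ← size, qHat, mul_div_cancel₀ _ hM.ne'] at this
  exact this.false

/-- This is what forces sets of large weight to be large. -/
theorem weight_le (U : Finset M.Vertex) : M.weight U ≤ U.card * M.maxQ / 2 := by
  rw [weight_eq]
  have h1 : ∑ e ∈ U.offDiagPairs, M.pairQ e ≤ (U.card.choose 2 : ℝ) * M.maxQ := by
    rw [← Finset.card_offDiagPairs, ← nsmul_eq_mul]
    refine Finset.sum_le_card_nsmul _ _ _ fun e _ => ?_
    induction e using Sym2.ind with
    | _ u v => rw [pairQ_mk]; exact M.Q_le_maxQ _ _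
  rcases U.eq_empty_or_nonempty with rfl | hU
  · simp
  have hc : (0 : ℝ) < U.card := by exact_mod_cast hU.card_pos
  rw [div_le_iff₀ hc]
  rw [Nat.cast_choose_two] at h1
  nlinarith [M.maxQ_nonneg, mul_nonneg hc.le M.maxQ_nonneg]

theorem card_vertex : (Fintype.card M.Vertex : ℝ) = M.size := by
  simp [size]

theorem weight_le_weightedIndepNum {G : SimpleGraph M.Vertex} {U : Finset M.Vertex}
    (hU : U.Nonempty) (hG : G.IsIndepSet (U : Set M.Vertex)) :
    M.weight U ≤ M.weightedIndepNum G := by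
  rw [weightedIndepNum]
  have hb : BddAbove (Set.range fun U : {U : Finset M.Vertex //
      U.Nonempty ∧ G.IsIndepSet (U : Set M.Vertex)} => M.weight U.1) :=
    (Set.finite_range _).bddAbove
  exact le_ciSup hb ⟨U, hU, hG⟩

/-- Nonnegativity of `t` covers the graph without vertices, where the real supremum over an empty
family is `0`. -/
theorem exists_lt_weight {G : SimpleGraph M.Vertex} {t : ℝ} (ht : 0 ≤ t)
    (h : t < M.weightedIndepNum G) :
    ∃ U : Finset M.Vertex, U.Nonempty ∧ G.IsIndepSet (U : Set M.Vertex) ∧ t < M.weight U := by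
  rw [weightedIndepNum] at h
  by_contra! h'
  refine h.not_ge (Real.iSup_le ?_ ht)
  rintro ⟨U, hU, hG⟩
  exact h' U hU hG

/-! ### Independent sets inside one block -/

/-- The vertices of a block that are given by a set of positions. -/
def blockSet (i : Fin M.k) (U : Finset (Fin (M.n i))) : Finset M.Vertex :=
  U.map ⟨Sigma.mk i, sigma_mk_injective⟩

theorem card_blockSet (i : Fin M.k) (U : Finset (Fin (M.n i))) :
    (M.blockSet i U).card = U.card :=
  Finset.card_map _

theorem pairQ_of_mem_blockSet {i : Fin M.k} {U : Finset (Fin (M.n i))} {e : Sym2 M.Vertex}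
    (he : e ∈ (M.blockSet i U).offDiagPairs) : M.pairQ e = M.Q i i := by
  induction e using Sym2.ind with
  | _ u v =>
    obtain ⟨hu, hv, -⟩ := Finset.mk_mem_offDiagPairs.1 he
    obtain ⟨a, -, rfl⟩ := Finset.mem_map.1 hu
    obtain ⟨b, -, rfl⟩ := Finset.mem_map.1 hv
    exact M.pairQ_mk _ _

theorem sum_pairQ_blockSet (i : Fin M.k) (U : Finset (Fin (M.n i))) :
    ∑ e ∈ (M.blockSet i U).offDiagPairs, M.pairQ e = U.card.choose 2 * M.Q i i := by
  rw [Finset.sum_congr rfl fun e he => M.pairQ_of_mem_blockSet he, Finset.sum_const,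
    Finset.card_offDiagPairs, card_blockSet, nsmul_eq_mul]

theorem weight_blockSet (i : Fin M.k) (U : Finset (Fin (M.n i))) :
    M.weight (M.blockSet i U) = U.card.choose 2 * M.Q i i / U.card := by
  rw [weight_eq, sum_pairQ_blockSet, card_blockSet]

theorem law_real_isIndepSet_blockSet (i : Fin M.k) (U : Finset (Fin (M.n i))) :
    M.law.real {G | G.IsIndepSet (M.blockSet i U : Set M.Vertex)} =
      Real.exp (-(U.card.choose 2 * M.Q i i)) := by
  rw [law_real_isIndepSet, sum_pairQ_blockSet]

/-- Pairs inside the overlap are counted once instead of twice, which gives the correlation factor.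
-/
theorem law_real_isIndepSet_blockSet_inter (i : Fin M.k) (U W : Finset (Fin (M.n i))) :
    M.law.real ({G | G.IsIndepSet (M.blockSet i U : Set M.Vertex)} ∩
        {G | G.IsIndepSet (M.blockSet i W : Set M.Vertex)}) =
      Real.exp (-(U.card.choose 2 * M.Q i i)) * Real.exp (-(W.card.choose 2 * M.Q i i)) *
        Real.exp ((U ∩ W).card.choose 2 * M.Q i i) := by
  classical
  have hset : {G : SimpleGraph M.Vertex | G.IsIndepSet (M.blockSet i U : Set M.Vertex)} ∩
      {G | G.IsIndepSet (M.blockSet i W : Set M.Vertex)} =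
      {G | ∀ e ∈ (M.blockSet i U).offDiagPairs ∪ (M.blockSet i W).offDiagPairs,
        e ∉ G.edgeSet} := by
    ext G
    simp only [Set.mem_inter_iff, Set.mem_ofPred_eq, Finset.isIndepSet_iff_offDiagPairs,
      Finset.mem_union, or_imp, forall_and]
  have hsum := Finset.sum_union_inter (s₁ := (M.blockSet i U).offDiagPairs)
    (s₂ := (M.blockSet i W).offDiagPairs) (f := M.pairQ)
  rw [Finset.offDiagPairs_inter, show M.blockSet i U ∩ M.blockSet i W = M.blockSet i (U ∩ W) by
    simp [blockSet, Finset.map_inter], sum_pairQ_blockSet, sum_pairQ_blockSet,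
    sum_pairQ_blockSet] at hsum
  rw [hset, law_real_forall_notMem_edgeSet, ← Real.exp_add, ← Real.exp_add]
  · congr 1
    linarith
  · intro e he
    rcases Finset.mem_union.1 he with he | he <;>
      exact Finset.not_isDiag_of_mem_offDiagPairs he

end StochasticBlockModel

/-! ### Binomial estimates and overlap counting -/

theorem Nat.choose_le_exp_mul_div_pow (n r : ℕ) :
    (n.choose r : ℝ) ≤ (Real.exp 1 * n / r) ^ r := by
  rcases r.eq_zero_or_pos with rfl | hr
  · simp
  have hr' : (0 : ℝ) < r := by exact_mod_cast hr
  refine (Nat.choose_le_pow_div r n).trans ?_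
  have h := Real.pow_div_factorial_le_exp (r : ℝ) hr'.le r
  have hf : (0 : ℝ) < (r.factorial : ℝ) := by exact_mod_cast r.factorial_pos
  rw [div_pow, mul_pow, ← Real.exp_nat_mul, mul_one]
  rw [div_le_iff₀ hf] at h
  rw [div_le_div_iff₀ hf (by positivity)]
  have h2 : (0 : ℝ) ≤ (n : ℝ) ^ r := by positivity
  nlinarith

/-- Factor by factor, `(u - l) / (n - l) ≤ u / n`. -/
theorem Nat.descFactorial_mul_pow_le {u n : ℕ} (h : u ≤ n) (l : ℕ) :
    u.descFactorial l * n ^ l ≤ n.descFactorial l * u ^ l := by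
  induction l with
  | zero => simp
  | succ l ih =>
    have h1 : (u - l) * n ≤ (n - l) * u := by
      rw [Nat.sub_mul, Nat.sub_mul, mul_comm n u]
      exact Nat.sub_le_sub_left (Nat.mul_le_mul_left l h) _
    rw [Nat.descFactorial_succ, Nat.descFactorial_succ, pow_succ, pow_succ]
    calc (u - l) * u.descFactorial l * (n ^ l * n)
        = ((u - l) * n) * (u.descFactorial l * n ^ l) := by ring
      _ ≤ ((n - l) * u) * (n.descFactorial l * u ^ l) := Nat.mul_le_mul h1 ih
      _ = _ := by ring

theorem Nat.choose_mul_pow_le {u n : ℕ} (h : u ≤ n) (l : ℕ) :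
    u.choose l * n ^ l ≤ n.choose l * u ^ l := by
  have := Nat.descFactorial_mul_pow_le h l
  rw [Nat.descFactorial_eq_factorial_mul_choose, Nat.descFactorial_eq_factorial_mul_choose,
    mul_assoc, mul_assoc] at this
  exact Nat.le_of_mul_le_mul_left this l.factorial_pos

theorem Finset.card_filter_subset_powersetCard_le {V : Type*} [Fintype V] [DecidableEq V]
    (S : Finset V) (u : ℕ) :
    (((univ : Finset V).powersetCard u).filter (S ⊆ ·)).card ≤
      (Fintype.card V - S.card).choose (u - S.card) := by
  rw [← card_compl, ← card_powersetCard]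
  refine card_le_card_of_injOn (· \ S) ?_ ?_
  · intro W hW
    simp only [coe_filter, mem_powersetCard, Set.mem_ofPred_eq] at hW
    simp only [mem_coe, mem_powersetCard]
    refine ⟨fun x hx => ?_, ?_⟩
    · simp only [mem_sdiff] at hx
      simpa using hx.2
    · rw [card_sdiff_of_subset hW.2, hW.1.2]
  · intro W hW W' hW' h
    simp only [coe_filter, mem_powersetCard, Set.mem_ofPred_eq] at hW hW'
    have h' : W \ S = W' \ S := h
    rw [← sdiff_union_of_subset hW.2, h', sdiff_union_of_subset hW'.2]

/-- The overlap `U ∩ W` is one of the sets `S ⊆ U` with `S ⊆ W`, so a sum over all such `S`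
dominates. Exchanging sums, the proportion of `u`-sets `W` containing a given `l`-set is at most `(u
/ n) ^ l`. Since `f 0 = 0`, disjoint pairs contribute nothing. -/
theorem Finset.sum_powersetCard_card_inter_le {V : Type*} [Fintype V] [DecidableEq V]
    (U : Finset V) {u : ℕ} (hU : U.card = u) (hu : u ≤ Fintype.card V)
    (hu0 : 0 < u) (f : ℕ → ℝ) (hf : ∀ l, 0 ≤ f l) (hf0 : f 0 = 0) :
    ∑ W ∈ (univ : Finset V).powersetCard u, f (U ∩ W).card ≤
      ((Fintype.card V).choose u : ℝ) *
        ∑ l ∈ Icc 1 u, (u.choose l : ℝ) * (u / Fintype.card V : ℝ) ^ l * f l := by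
  set n := Fintype.card V with hn
  have h1 : ∀ W : Finset V, f (U ∩ W).card ≤
      ∑ l ∈ Icc 1 u, ∑ S ∈ U.powersetCard l, if S ⊆ W then f l else 0 := by
    intro W
    have hnn : ∀ l, ∀ S ∈ U.powersetCard l, 0 ≤ if S ⊆ W then f l else 0 := by
      intro l S _
      split_ifs
      exacts [hf l, le_rfl]
    rcases Nat.eq_zero_or_pos (U ∩ W).card with h0 | hpos
    · rw [h0, hf0]
      exact sum_nonneg fun l _ => sum_nonneg (hnn l)
    · have hmem : (U ∩ W).card ∈ Icc 1 u :=
        mem_Icc.2 ⟨hpos, hU ▸ card_le_card inter_subset_left⟩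
      refine le_trans ?_ (single_le_sum (fun l _ => sum_nonneg (hnn l)) hmem)
      have hS : U ∩ W ∈ U.powersetCard (U ∩ W).card := mem_powersetCard.2 ⟨inter_subset_left, rfl⟩
      refine le_trans ?_ (single_le_sum (hnn _) hS)
      rw [if_pos inter_subset_right]
  refine (sum_le_sum fun W _ => h1 W).trans ?_
  rw [sum_comm, mul_sum]
  refine sum_le_sum fun l hl => ?_
  obtain ⟨hl1, hlu⟩ := mem_Icc.1 hl
  rw [sum_comm]
  have h2 : ∀ S ∈ U.powersetCard l,
      ∑ W ∈ (univ : Finset V).powersetCard u, (if S ⊆ W then f l else 0) ≤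
        (n.choose u : ℝ) * (u / n : ℝ) ^ l * f l := by
    intro S hS
    rw [← sum_filter, sum_const, nsmul_eq_mul]
    refine mul_le_mul_of_nonneg_right ?_ (hf l)
    have hc := card_filter_subset_powersetCard_le S u
    rw [(mem_powersetCard.1 hS).2] at hc
    have hn0 : (0 : ℝ) < n := by exact_mod_cast hu0.trans_le hu
    have h3 := Nat.choose_mul_pow_le hu l
    have h4 := Nat.choose_mul (n := n) (k := u) (s := l) hlu
    have h5 : 0 < n.choose l := Nat.choose_pos (hlu.trans hu)
    have h6 : (n - l).choose (u - l) * n ^ l ≤ n.choose u * u ^ l := by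
      refine le_of_mul_le_mul_left ?_ h5
      calc n.choose l * ((n - l).choose (u - l) * n ^ l)
          = n.choose u * (u.choose l * n ^ l) := by rw [← mul_assoc, ← h4, mul_assoc]
        _ ≤ n.choose u * (n.choose l * u ^ l) := Nat.mul_le_mul_left _ h3
        _ = _ := by ring
    rw [div_pow, ← mul_div_assoc, le_div_iff₀ (by positivity)]
    calc _ ≤ ((n - l).choose (u - l) : ℝ) * (n : ℝ) ^ l := by
          gcongr
      _ ≤ _ := by exact_mod_cast h6
  refine (sum_le_sum h2).trans (le_of_eq ?_)
  rw [sum_const, card_powersetCard, hU, nsmul_eq_mul]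
  ring

theorem sum_Icc_one_pow_le {b : ℝ} (hb0 : 0 ≤ b) (hb : b ≤ 1 / 2) (u : ℕ) :
    ∑ l ∈ Finset.Icc 1 u, b ^ l ≤ 2 * b := by
  have h : ∑ l ∈ Finset.Icc 1 u, b ^ l = b * ∑ l ∈ Finset.range u, b ^ l := by
    rw [Finset.range_eq_Ico, Finset.mul_sum, Finset.sum_Ico_eq_sum_range,
      ← Finset.Ico_add_one_right_eq_Icc, Finset.sum_Ico_eq_sum_range]
    refine Finset.sum_congr (by simp) fun l _ => ?_
    rw [add_comm, pow_succ', zero_add]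
  have h2 : ∑ l ∈ Finset.range u, b ^ l ≤ 2 := by
    calc ∑ l ∈ Finset.range u, b ^ l ≤ ∑' l, b ^ l :=
          (summable_geometric_of_lt_one hb0 (by linarith)).sum_le_tsum _ fun l _ => by positivity
      _ = (1 - b)⁻¹ := tsum_geometric_of_lt_one hb0 (by linarith)
      _ ≤ 2 := by
          rw [inv_le_comm₀ (by linarith) (by norm_num)]
          linarith
  rw [h]
  nlinarith

/-! ### First and second moment bounds -/

namespace StochasticBlockModel

variable (M : StochasticBlockModel)

theorem law_real_lt_weightedIndepNum_le {t s b : ℝ} (ht : 0 ≤ t) (hs0 : 0 < s)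
    (hs : ∀ u : ℕ, t < u * M.maxQ / 2 → s ≤ u)
    (hb : Real.exp 1 * M.size / s * Real.exp (-t) ≤ b) (hb2 : b ≤ 1 / 2) :
    M.law.real {G | t < M.weightedIndepNum G} ≤ 2 * b := by
  classical
  set N := Fintype.card M.Vertex with hN
  have hNs : (N : ℝ) = M.size := M.card_vertex
  have hsz : 0 ≤ M.size := hNs ▸ N.cast_nonneg
  have hb0 : 0 ≤ b := le_trans (by positivity) hb
  -- The cutoff at `s` is what later allows `u` to be replaced by `s` in the base `e ‖n‖ / u`.
  let g : ℕ → ℝ := fun u => if 1 ≤ u ∧ s ≤ u then Real.exp (-(u * t)) else 0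
  have hg : ∀ u, 0 ≤ g u := fun u => by
    simp only [g]; split_ifs
    exacts [Real.exp_nonneg _, le_rfl]
  let F : Finset (Finset M.Vertex) :=
    (Finset.univ : Finset M.Vertex).powerset.filter fun U => U.Nonempty ∧ t < M.weight U
  have hsub : {G | t < M.weightedIndepNum G} ⊆
      ⋃ U ∈ F, {G : SimpleGraph M.Vertex | G.IsIndepSet (U : Set M.Vertex)} := by
    intro G hG
    obtain ⟨U, hU, hind, hw⟩ := M.exists_lt_weight ht hG
    refine Set.mem_biUnion (x := U) ?_ hind
    simp [F, hU, hw]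
  have hF : ∀ U ∈ F, M.law.real {G | G.IsIndepSet (U : Set M.Vertex)} ≤ g U.card := by
    intro U hU
    obtain ⟨-, hne, hw⟩ := Finset.mem_filter.1 hU
    have h1 : 1 ≤ U.card ∧ s ≤ (U.card : ℝ) :=
      ⟨hne.card_pos, hs _ (hw.trans_le (M.weight_le U))⟩
    rw [M.law_real_isIndepSet_eq_exp_weight hne]
    simp only [g, if_pos h1]
    gcongr
  calc M.law.real {G | t < M.weightedIndepNum G}
      ≤ M.law.real (⋃ U ∈ F, {G : SimpleGraph M.Vertex | G.IsIndepSet (U : Set M.Vertex)}) :=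
        measureReal_mono hsub (measure_ne_top _ _)
    _ ≤ ∑ U ∈ F, M.law.real {G | G.IsIndepSet (U : Set M.Vertex)} :=
        measureReal_biUnion_finset_le _ _
    _ ≤ ∑ U ∈ F, g U.card := Finset.sum_le_sum hF
    _ ≤ ∑ U ∈ (Finset.univ : Finset M.Vertex).powerset, g U.card :=
        Finset.sum_le_sum_of_subset_of_nonneg (Finset.filter_subset _ _) fun U _ _ => hg _
    _ = ∑ u ∈ Finset.range (N + 1), N.choose u • g u := by
        rw [Finset.sum_powerset_apply_card, Finset.card_univ]
    _ = ∑ u ∈ Finset.Icc 1 N, N.choose u • g u := by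
        rw [Finset.range_eq_Ico, ← Finset.Ico_add_one_right_eq_Icc,
          Finset.sum_eq_sum_Ico_succ_bot (by omega)]
        simp [g]
    _ ≤ ∑ u ∈ Finset.Icc 1 N, b ^ u := by
        refine Finset.sum_le_sum fun u hu => ?_
        rw [nsmul_eq_mul]
        by_cases h : 1 ≤ u ∧ s ≤ u
        · have hu0 : (0 : ℝ) < u := by exact_mod_cast h.1
          simp only [g, if_pos h]
          calc (N.choose u : ℝ) * Real.exp (-(u * t))
              ≤ (Real.exp 1 * N / u) ^ u * Real.exp (-(u * t)) := by
                gcongr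
                exact Nat.choose_le_exp_mul_div_pow _ _
            _ = (Real.exp 1 * M.size / u * Real.exp (-t)) ^ u := by
                rw [hNs, mul_pow _ (Real.exp (-t)), ← Real.exp_nat_mul, mul_neg]
            _ ≤ (Real.exp 1 * M.size / s * Real.exp (-t)) ^ u := by
                gcongr
                exact h.2
            _ ≤ b ^ u := by gcongr
        · simp only [g, if_neg h, mul_zero]
          positivity
    _ ≤ 2 * b := sum_Icc_one_pow_le hb0 hb2 _

/-- The variance divided by the squared mean is an overlap sum whose `l`-th term is at most `b ^ l`;
the factor `(l - 1) / 2` is `l.choose 2 / l`. -/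
theorem law_real_forall_not_isIndepSet_le (i : Fin M.k) {u : ℕ} (hu0 : 0 < u) (hu : u ≤ M.n i)
    {b : ℝ} (hb2 : b ≤ 1 / 2)
    (hb : ∀ l : ℕ, 1 ≤ l → l ≤ u →
      Real.exp 1 * u / l * (u / M.n i) * Real.exp ((l - 1) / 2 * M.Q i i) ≤ b) :
    M.law.real {G | ∀ U ∈ (Finset.univ : Finset (Fin (M.n i))).powersetCard u,
      ¬ G.IsIndepSet (M.blockSet i U : Set M.Vertex)} ≤ 2 * b := by
  classical
  set q := M.Q i i with hq
  have hq0 : 0 ≤ q := M.Q_nonneg i i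
  set n := M.n i with hn
  have hb0 : 0 ≤ b := le_trans (by positivity) (hb u hu0 le_rfl)
  set F := (Finset.univ : Finset (Fin n)).powersetCard u with hF
  set a := Real.exp (-(u.choose 2 * q)) with ha
  have ha0 : 0 < a := Real.exp_pos _
  have hc0 : (0 : ℝ) < n.choose u := by exact_mod_cast Nat.choose_pos hu
  let A : Finset (Fin n) → Set (SimpleGraph M.Vertex) :=
    fun U => {G | G.IsIndepSet (M.blockSet i U : Set M.Vertex)}
  have hA : ∀ U ∈ F, M.law.real (A U) = a := fun U hU => by
    rw [ha, ← (Finset.mem_powersetCard.1 hU).2]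
    exact M.law_real_isIndepSet_blockSet i U
  let f : ℕ → ℝ := fun l => Real.exp (l.choose 2 * q) - 1
  have hf : ∀ l, 0 ≤ f l := fun l =>
    sub_nonneg.2 (Real.one_le_exp (by positivity))
  have hAA : ∀ U ∈ F, ∀ W ∈ F, M.law.real (A U ∩ A W) - M.law.real (A U) * M.law.real (A W) =
      a ^ 2 * f (U ∩ W).card := fun U hU W hW => by
    have := M.law_real_isIndepSet_blockSet_inter i U W
    rw [(Finset.mem_powersetCard.1 hU).2, (Finset.mem_powersetCard.1 hW).2] at this
    rw [hA U hU, hA W hW]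
    change M.law.real (A U ∩ A W) = a * a * Real.exp ((U ∩ W).card.choose 2 * q) at this
    rw [this]
    simp only [f]
    ring
  have hsm := measureReal_forall_notMem_le M.law F A
  rw [Finset.sum_congr rfl hA, Finset.sum_congr rfl fun U hU => Finset.sum_congr rfl (hAA U hU),
    Finset.sum_const, hF, Finset.card_powersetCard, ← hF, Finset.card_univ, Fintype.card_fin,
    nsmul_eq_mul] at hsm
  have hsum : ∑ l ∈ Finset.Icc 1 u, (u.choose l : ℝ) * (u / n : ℝ) ^ l * f l ≤ 2 * b := by
    refine (Finset.sum_le_sum fun l hl => ?_).trans (sum_Icc_one_pow_le hb0 hb2 u)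
    obtain ⟨hl1, hlu⟩ := Finset.mem_Icc.1 hl
    calc (u.choose l : ℝ) * (u / n : ℝ) ^ l * f l
        ≤ (Real.exp 1 * u / l) ^ l * (u / n : ℝ) ^ l * Real.exp (l.choose 2 * q) := by
          gcongr
          · exact hf l
          · exact Nat.choose_le_exp_mul_div_pow _ _
          · simp only [f]; linarith
      _ = (Real.exp 1 * u / l * (u / n) * Real.exp ((l - 1) / 2 * q)) ^ l := by
          rw [mul_pow, mul_pow, ← Real.exp_nat_mul, Nat.cast_choose_two]
          ring_nf
      _ ≤ b ^ l := by
          gcongr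
          exact hb l hl1 hlu
  have hbd : ∀ U ∈ F, ∑ W ∈ F, a ^ 2 * f (U ∩ W).card ≤ a ^ 2 * (n.choose u * (2 * b)) := by
    intro U hU
    rw [← Finset.mul_sum]
    refine mul_le_mul_of_nonneg_left ?_ (by positivity)
    have := Finset.sum_powersetCard_card_inter_le U (Finset.mem_powersetCard.1 hU).2
      (by simpa using hu) hu0 f hf (by simp [f])
    rw [Fintype.card_fin] at this
    exact this.trans (mul_le_mul_of_nonneg_left hsum hc0.le)
  have htot := hsm.trans (Finset.sum_le_sum hbd)
  rw [Finset.sum_const, hF, Finset.card_powersetCard, ← hF, Finset.card_univ, Fintype.card_fin,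
    nsmul_eq_mul] at htot
  have hpos : 0 < (n.choose u * a : ℝ) ^ 2 := by positivity
  refine le_of_mul_le_mul_left (htot.trans (le_of_eq ?_)) hpos
  ring

end StochasticBlockModel

/-- The logarithm `(l - 1) / 2 * q - log l` is convex in `l`, so its maximum is at an endpoint; at
`l = 1` it is zero. -/
theorem exp_div_le_max_of_mem_Icc {q l u : ℝ} (hl : 1 ≤ l) (hlu : l ≤ u) :
    Real.exp ((l - 1) / 2 * q) / l ≤ max 1 (Real.exp ((u - 1) / 2 * q) / u) := by
  have hl0 : 0 < l := by linarith
  have hu0 : 0 < u := by linarith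
  have hconv : ConvexOn ℝ (Set.Ioi 0) fun x : ℝ => (x - 1) / 2 * q + -Real.log x := by
    refine ConvexOn.add ?_ strictConcaveOn_log_Ioi.concaveOn.neg
    refine ⟨convex_Ioi 0, fun x _ y _ a b _ _ hab => le_of_eq ?_⟩
    simp only [smul_eq_mul]
    linear_combination (q / 2) * hab
  have h := hconv.le_max_of_mem_Icc (x := 1) (y := u) (z := l) (by simp) hu0 ⟨hl, hlu⟩
  have hexp : ∀ x : ℝ, 0 < x →
      Real.exp ((x - 1) / 2 * q + -Real.log x) = Real.exp ((x - 1) / 2 * q) / x := fun x hx => by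
    rw [Real.exp_add, Real.exp_neg, Real.exp_log hx]
    exact (div_eq_mul_inv _ _).symm
  rw [← hexp l hl0, ← hexp u hu0]
  rcases le_max_iff.1 h with h | h
  · exact le_max_of_le_left (by simpa using h)
  · exact le_max_of_le_right (Real.exp_le_exp.2 h)

/-! ### Tail bounds at the scale of `log ‖n‖` -/

namespace StochasticBlockModel

variable (M : StochasticBlockModel)

theorem law_real_weightedIndepNum_gt_le {L σ ε δ : ℝ} (hL : 0 < L) (hδ : 0 < δ)
    (hε : ε = 16 * δ) (hσ : σ ≤ 1 / 2) (hsize : M.size = Real.exp L)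
    (hstar : 0 < M.qStar) (hstar' : M.qStar ≤ Real.exp ((-σ + δ) * L))
    (hmax : (1 + 1 / M.qStar) * M.maxQ ≤ δ * L)
    (hb : Real.exp 1 * Real.exp (-δ * L) ≤ 1 / 2) :
    M.law.real {G | (1 - σ + ε) * L < M.weightedIndepNum G} ≤
      2 * (Real.exp 1 * Real.exp (-δ * L)) := by
  have hm0 := M.maxQ_nonneg
  refine M.law_real_lt_weightedIndepNum_le (s := Real.exp ((σ - δ) * L)) (by nlinarith)
    (Real.exp_pos _) ?_ ?_ hb
  · intro u hu
    have h1 : M.maxQ ≤ δ * L * M.qStar := by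
      have : 1 / M.qStar * M.maxQ ≤ δ * L := by linarith
      rw [one_div, inv_mul_le_iff₀ hstar] at this
      linarith
    have h2 : L ≤ L * (u * M.qStar) := by
      have h3 : (u : ℝ) * M.maxQ ≤ u * (δ * L * M.qStar) := by gcongr
      have h4 : (0 : ℝ) ≤ L * (u * M.qStar) := by positivity
      nlinarith
    have h3 : 1 ≤ u * M.qStar := by
      refine le_of_mul_le_mul_left ?_ hL
      linarith
    have h4 : 1 ≤ u * Real.exp ((-σ + δ) * L) := h3.trans (by gcongr)
    have h5 : Real.exp ((σ - δ) * L) = (Real.exp ((-σ + δ) * L))⁻¹ := by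
      rw [← Real.exp_neg]; ring_nf
    rw [h5]
    exact (inv_le_iff_one_le_mul₀ (Real.exp_pos _)).2 h4
  · rw [hsize, mul_div_assoc, mul_assoc, ← Real.exp_sub, ← Real.exp_add]
    gcongr
    -- The exponent is `1 - (σ - δ) - (1 - σ + 16 δ) = -15 δ`, times `L`.
    nlinarith [mul_pos hL hδ]

theorem law_real_weightedIndepNum_lt_le {L σ σ₀ ε δ : ℝ} (hL : 0 < L) (hδ : 0 < δ)
    (hε : ε = 16 * δ) (hσ₀ : 0 < σ₀) (hεσ : ε ≤ 1 - 2 * σ₀) (hσ0 : 0 ≤ σ) (hσ : σ ≤ σ₀)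
    (hL4 : 4 * L ≤ Real.exp (δ * L)) (hsize : M.size = Real.exp L)
    (hstar : 0 < M.qStar) (hhat : Real.exp ((-σ - δ) * L) ≤ M.qHat)
    (hmax : (1 + 1 / M.qStar) * M.maxQ ≤ δ * L)
    (hmin : Real.exp ((1 - δ) * L) ≤ M.minBlock)
    (hb : Real.exp 1 * Real.exp (-δ * L) ≤ 1 / 2) :
    M.law.real {G | M.weightedIndepNum G < (1 - σ - ε) * L} ≤
      2 * (Real.exp 1 * Real.exp (-δ * L)) := by
  have hm0 := M.maxQ_nonneg
  obtain ⟨i, hi⟩ := M.exists_qHat_le (hsize ▸ Real.exp_pos L)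
  have hq := hhat.trans hi
  have hn := hmin.trans (M.minBlock_le i)
  set q := M.Q i i with hqdef
  have hq0 : 0 < q := (Real.exp_pos _).trans_le hq
  have hqL : q ≤ δ * L := by
    have h1 : 0 ≤ 1 / M.qStar * M.maxQ := by positivity
    linarith [M.Q_le_maxQ i i]
  set c := 1 - σ - ε with hc
  have hc0 : 0 < c := by linarith
  have hc1 : c ≤ 1 := by linarith
  -- A set of `r + 1` vertices of the block has weight `r / 2 * q`, so this is the least `r`
  -- reaching `c * L`; rounding up costs at most `q / 2 ≤ δ * L`.
  set r := ⌈2 * c * L / q⌉₊ with hr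
  have hr1 : 2 * c * L / q ≤ r := Nat.le_ceil _
  have hr2 : (r : ℝ) < 2 * c * L / q + 1 := Nat.ceil_lt_add_one (by positivity)
  have hrq1 : c * L ≤ r / 2 * q := by
    rw [div_le_iff₀ hq0] at hr1
    linarith
  have hrq2 : r / 2 * q ≤ (c + δ) * L := by
    have : (r : ℝ) * q ≤ 2 * c * L + q := by
      have := mul_le_mul_of_nonneg_right hr2.le hq0.le
      rwa [add_mul, div_mul_cancel₀ _ hq0.ne', one_mul] at this
    nlinarith
  have hu : ((r + 1 : ℕ) : ℝ) ≤ Real.exp ((σ + 2 * δ) * L) := by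
    have h1 : ((r + 1 : ℕ) : ℝ) * q ≤ 4 * L := by
      push_cast
      have hδ1 : δ ≤ 1 / 16 := by linarith
      nlinarith
    have h2 : ((r + 1 : ℕ) : ℝ) * Real.exp ((-σ - δ) * L) ≤ Real.exp (δ * L) :=
      (mul_le_mul_of_nonneg_left hq (Nat.cast_nonneg _)).trans (h1.trans hL4)
    rw [← le_div_iff₀ (Real.exp_pos _), ← Real.exp_sub] at h2
    refine h2.trans (Real.exp_le_exp.2 (le_of_eq ?_))
    ring
  set u := r + 1 with hudef
  have hu0 : (0 : ℝ) < u := by positivity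
  have hur : (u : ℝ) - 1 = r := by simp [hudef]
  have hnpos : (0 : ℝ) < M.n i := (Real.exp_pos _).trans_le hn
  have hun : u ≤ M.n i := by
    have : (u : ℝ) ≤ M.n i := by
      refine hu.trans (le_trans (Real.exp_le_exp.2 ?_) hn)
      gcongr
      linarith
    exact_mod_cast this
  have hratio : (u : ℝ) / M.n i ≤ Real.exp ((σ + 2 * δ) * L - (1 - δ) * L) := by
    rw [Real.exp_sub]
    gcongr
  refine le_trans (measureReal_mono ?_ (measure_ne_top _ _))
    (M.law_real_forall_not_isIndepSet_le i (u := u) (Nat.succ_pos _) hun hb ?_)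
  · intro G hG U hU hind
    have hcard := (Finset.mem_powersetCard.1 hU).2
    have hne : (M.blockSet i U).Nonempty := by
      rw [← Finset.card_pos, card_blockSet, hcard]
      exact Nat.succ_pos _
    have hw := M.weight_le_weightedIndepNum hne hind
    rw [weight_blockSet, hcard, Nat.cast_choose_two, hur] at hw
    have : (u : ℝ) * r / 2 * q / u = r / 2 * q := by field_simp
    rw [this] at hw
    exact absurd hG (not_lt.2 (hrq1.trans hw))
  · intro l hl hlu
    have hl1 : (1 : ℝ) ≤ l := by exact_mod_cast hl
    have hlu' : (l : ℝ) ≤ u := by exact_mod_cast hlu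
    have hmaxi := exp_div_le_max_of_mem_Icc (q := q) hl1 hlu'
    rw [hur] at hmaxi
    -- The two entries of the maximum are overlap one, needing `2 σ + 6 δ ≤ 1`, and full overlap,
    -- needing `c + 5 δ ≤ 1 - σ`. Both follow from `ε = 16 δ ≤ 1 - 2 σ₀`.
    have hbase : u * (u / M.n i) * max 1 (Real.exp (r / 2 * q) / u) ≤ Real.exp (-δ * L) := by
      rw [mul_max_of_nonneg _ _ (by positivity), max_le_iff]
      constructor
      · calc u * (u / M.n i) * (1 : ℝ)
            ≤ Real.exp ((σ + 2 * δ) * L) * Real.exp ((σ + 2 * δ) * L - (1 - δ) * L) * 1 := by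
              gcongr
          _ ≤ Real.exp (-δ * L) := by
              rw [mul_one, ← Real.exp_add, Real.exp_le_exp]
              have : 0 ≤ (1 - 2 * σ - 6 * δ) * L := mul_nonneg (by linarith) hL.le
              linarith
      · calc u * (u / M.n i) * (Real.exp (r / 2 * q) / u)
            = u / M.n i * Real.exp (r / 2 * q) := by field_simp
          _ ≤ Real.exp ((σ + 2 * δ) * L - (1 - δ) * L) * Real.exp ((c + δ) * L) := by
              gcongr
          _ ≤ Real.exp (-δ * L) := by
              rw [← Real.exp_add, Real.exp_le_exp]
              have : 0 ≤ (1 - σ - c - 5 * δ) * L := mul_nonneg (by linarith) hL.le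
              linarith
    calc Real.exp 1 * u / l * (u / M.n i) * Real.exp ((l - 1) / 2 * q)
        = Real.exp 1 * (u * (u / M.n i) * (Real.exp ((l - 1) / 2 * q) / l)) := by
          field_simp
      _ ≤ Real.exp 1 * (u * (u / M.n i) * max 1 (Real.exp (r / 2 * q) / u)) := by
          gcongr
      _ ≤ Real.exp 1 * Real.exp (-δ * L) := by gcongr

end StochasticBlockModel

/-! ### Passage to the limit -/

theorem EqPowLittleO.eventually_mem_Icc {ι : Type*} {l : Filter ι} {X Y a : ι → ℝ}
    (h : EqPowLittleO l X Y a) (hY : Tendsto Y l atTop) {δ : ℝ} (hδ : 0 < δ) :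
    ∀ᶠ i in l, X i ∈ Set.Icc (Real.exp ((a i - δ) * Real.log (Y i)))
      (Real.exp ((a i + δ) * Real.log (Y i))) := by
  obtain ⟨e, he, hX⟩ := h
  filter_upwards [hX, he.eventually (Icc_mem_nhds (neg_lt_zero.2 hδ) hδ),
    hY.eventually_gt_atTop 1] with i hXi hei hYi
  have hlog : 0 ≤ Real.log (Y i) := Real.log_nonneg hYi.le
  rw [hXi, Real.rpow_def_of_pos (by linarith), mul_comm (Real.log _)]
  refine ⟨Real.exp_le_exp.2 ?_, Real.exp_le_exp.2 ?_⟩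
  · exact mul_le_mul_of_nonneg_right (by linarith [hei.1]) hlog
  · exact mul_le_mul_of_nonneg_right (by linarith [hei.2]) hlog

/-- The models are indexed by `(m, t)` with `m : ℕ` and `t : T`, and limits along `atTop ×ˢ ⊤` are
limits as `m → ∞`, uniformly in `t`; a single sequence of models is the case of a one-point `T`. -/
theorem theorem4p4 {T : Type*} (M : ℕ × T → StochasticBlockModel)
    (σ₀ : ℝ) (hσ₀ : 0 < σ₀) (hσ₀' : σ₀ < 1 / 2)
    (σ : ℕ × T → ℝ) (hσ : ∀ i, σ i ∈ Set.Icc 0 σ₀)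
    (h_size : Tendsto (fun i => (M i).size) (atTop ×ˢ ⊤) atTop)
    (h_k : EqPowLittleO (atTop ×ˢ ⊤) (fun i => ((M i).k : ℝ)) (fun i => (M i).size) (fun _ => 0))
    (h_qStar : EqPowLittleO (atTop ×ˢ ⊤) (fun i => (M i).qStar) (fun i => (M i).size)
      (fun i => -σ i))
    (h_qHat : EqPowLittleO (atTop ×ˢ ⊤) (fun i => (M i).qHat) (fun i => (M i).size)
      (fun i => -σ i))
    (h_maxQ : (fun i => (1 + 1 / (M i).qStar) * (M i).maxQ) =o[atTop ×ˢ ⊤]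
      fun i => Real.log (M i).size)
    (h_minBlock : EqPowLittleO (atTop ×ˢ ⊤) (fun i => (M i).minBlock) (fun i => (M i).size)
      (fun _ => 1))
    (h_w : (fun i => (M i).w / Real.log (M i).size) =o[atTop ×ˢ ⊤] fun i => (M i).minBlock)
    (ε : ℝ) (hε : 0 < ε) :
    Tendsto
      (fun i => (M i).law.real {G |
        (1 - σ i - ε) * Real.log (M i).size ≤ (M i).weightedIndepNum G ∧
        (M i).weightedIndepNum G ≤ (1 - σ i + ε) * Real.log (M i).size})
      (atTop ×ˢ ⊤) (𝓝 1) := by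

  have hL : Tendsto (fun i => Real.log (M i).size) (atTop ×ˢ ⊤) atTop :=
    Real.tendsto_log_atTop.comp h_size
  -- Shrinking `ε` only strengthens the claim, and the cap keeps the lower threshold positive and
  -- the overlap-one term small.
  set ε' := min ε (1 - 2 * σ₀) with hε'
  have hε'0 : 0 < ε' := lt_min hε (by linarith)
  have hε'σ : ε' ≤ 1 - 2 * σ₀ := min_le_right _ _
  set δ := ε' / 16 with hδ
  have hδ0 : 0 < δ := by positivity
  have hδL : Tendsto (fun i => δ * Real.log (M i).size) (atTop ×ˢ ⊤) atTop :=
    hL.const_mul_atTop hδ0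
  set b : ℕ × T → ℝ := fun i => Real.exp 1 * Real.exp (-δ * Real.log (M i).size) with hb
  have hb0 : Tendsto b (atTop ×ˢ ⊤) (𝓝 0) := by
    have := (Real.tendsto_exp_neg_atTop_nhds_zero.comp hδL).const_mul (Real.exp 1)
    simpa [hb, Function.comp_def] using this
  have hL4 : ∀ᶠ i in atTop ×ˢ ⊤,
      4 * Real.log (M i).size ≤ Real.exp (δ * Real.log (M i).size) := by
    have h := (Real.tendsto_exp_div_pow_atTop 1).comp hδL
    filter_upwards [h.eventually_ge_atTop (4 / δ), hL.eventually_gt_atTop 0] with i hi hLi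
    rw [Function.comp_apply, pow_one, div_le_div_iff₀ hδ0 (by positivity)] at hi
    refine le_of_mul_le_mul_right (le_trans (le_of_eq ?_) hi) hδ0
    ring
  -- Each of the two tails costs `2 * b i`.
  have key : ∀ᶠ i in atTop ×ˢ ⊤, 1 - 4 * b i ≤ (M i).law.real {G |
      (1 - σ i - ε) * Real.log (M i).size ≤ (M i).weightedIndepNum G ∧
      (M i).weightedIndepNum G ≤ (1 - σ i + ε) * Real.log (M i).size} := by
    filter_upwards [hL4, hL.eventually_gt_atTop 0, h_size.eventually_gt_atTop 0,
      hb0.eventually_le_const (show (0 : ℝ) < 1 / 2 by norm_num),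
      h_qStar.eventually_mem_Icc h_size hδ0, h_qHat.eventually_mem_Icc h_size hδ0,
      h_minBlock.eventually_mem_Icc h_size hδ0, h_maxQ.bound hδ0]
      with i hi4 hLi hsi hbi hstar hhat hmin hmax
    have hsize : (M i).size = Real.exp (Real.log (M i).size) := (Real.exp_log hsi).symm
    have hstar0 : 0 < (M i).qStar := (Real.exp_pos _).trans_le hstar.1
    have hmax' : (1 + 1 / (M i).qStar) * (M i).maxQ ≤ δ * Real.log (M i).size := by
      refine (le_abs_self _).trans (hmax.trans (le_of_eq ?_))
      rw [Real.norm_of_nonneg hLi.le]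
    have hup := (M i).law_real_weightedIndepNum_gt_le (ε := ε') hLi hδ0 (by rw [hδ]; ring)
      ((hσ i).2.trans hσ₀'.le) hsize hstar0 hstar.2 hmax' hbi
    have hlow := (M i).law_real_weightedIndepNum_lt_le (ε := ε') hLi hδ0 (by rw [hδ]; ring)
      hσ₀ hε'σ (hσ i).1 (hσ i).2 hi4 hsize hstar0 hhat.1 hmax' hmin.1 hbi
    set S := {G | (1 - σ i - ε) * Real.log (M i).size ≤ (M i).weightedIndepNum G ∧
      (M i).weightedIndepNum G ≤ (1 - σ i + ε) * Real.log (M i).size} with hS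
    have hεε : ε' * Real.log (M i).size ≤ ε * Real.log (M i).size :=
      mul_le_mul_of_nonneg_right (min_le_left _ _) hLi.le
    have hsub : Sᶜ ⊆ {G | (1 - σ i + ε') * Real.log (M i).size < (M i).weightedIndepNum G} ∪
        {G | (M i).weightedIndepNum G < (1 - σ i - ε') * Real.log (M i).size} := by
      intro G hG
      by_contra h
      simp only [Set.mem_union, Set.mem_ofPred_eq, not_or, not_lt] at h
      exact hG ⟨by linarith [h.2], by linarith [h.1]⟩
    have h1 := (measureReal_mono hsub (measure_ne_top (M i).law _)).trans
      (measureReal_union_le _ _)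
    rw [probReal_compl_eq_one_sub MeasurableSet.of_discrete] at h1
    linarith
  refine tendsto_of_tendsto_of_tendsto_of_le_of_le' ?_ tendsto_const_nhds key
    (Eventually.of_forall fun i => measureReal_le_one)
  simpa using (hb0.const_mul 4).const_sub 1
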